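/- Let $k$ be a field, let $Y$ be a scheme of finite type over $k$, and let $n\ge 0$ and $d$ be integers. Put $\square=\mathbb P^1_k\setminus\{1\}$ and $\square^n_Y=Y\times_k\square^n$ (with $\square^0=\operatorname{Spec} k$). A face of $\square^n_Y$ is a closed subscheme $Y\times F$, where $F\subset\square^n$ is given by equations $y_{i_1}=\epsilon_1,\dots,y_{i_s}=\epsilon_s$ with $i_1<\dots<i_s$ and $\epsilon_j\in\{0,\infty\}$ ($s=0$ is allowed). Let $\underline z_d(Y,n)$ be the free abelian group on the integral closed subschemes $Z\subset\square^n_Y$ of dimension $d+n$ that intersect every face $Y\times F$ properly, i.e. $\dim(Z\cap(Y\times F))\le\dim Z-\operatorname{codim}F$ for all $F$. Let $\underline z_d(Y,n)_{\rm degn}$ be the subgroup generated by the pull-backs of cycles in $\underline z_d(Y,n-1)$ along the projections $\square^n_Y\to\square^{n-1}_Y$ forgetting one coordinate (it is $0$ for $n=0$), and put $z_d(Y,n)=\underline z_d(Y,n)/\underline z_d(Y,n)_{\rm degn}$. For a closed subset $W\subset Y$ let $$G_d(W,n)=\ker\bigl(z_d(Y,n)\to z_d(Y\setminus W,n)\bigr),$$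 the kernel of the restriction of cycles; this is the group of cycles in $z_d(Y,n)$ supported over $W$. For $V\subset U$ open in $Y$ one has $G_d(Y\setminus U,n)\subset G_d(Y\setminus V,n)$. Consider the presheaf of abelian groups on $Y_{\rm Zar}$ $$\mathcal S_{n,d}:\ U\mapsto \frac{z_d(Y,n)}{G_d(Y\setminus U,n)},$$ whose restriction maps $\rho^U_V$ are the natural quotient maps. Then $\mathcal S_{n,d}$ is a flasque sheaf on $Y_{\rm Zar}$. Moreover, for any two open subsets $U,V\subset Y$ the sequence $$0\to\mathcal S_{n,d}(U\cup V)\xrightarrow{\ \delta_0\ }\mathcal S_{n,d}(U)\oplus\mathcal S_{n,d}(V)\xrightarrow{\ \delta_1\ }\mathcal S_{n,d}(U\cap V)\to0$$ is exact, where $\delta_0=(\rho^{U\cup V}_U,\rho^{U\cup V}_V)$ and $\delta_1(x_1,x_2)=\rho^U_{U\cap V}(x_1)-\rho^V_{U\cap V}(x_2)$. -/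

import Mathlib

open CategoryTheory Limits AlgebraicGeometry TopologicalSpace
universe u

/-! Preparations from dimension theory: for a scheme locally of finite type over a field, a non-empty
open subset of an irreducible closed subset has the same Krull dimension. This is needed for the
restriction of cycles to open subschemes to be well defined. -/

theorem ringKrullDim_eq_of_integral_injective {A B : Type*} [CommRing A] [CommRing B] [IsDomain B] [Algebra A B]
    [Algebra.IsIntegral A B] (h : Function.Injective (algebraMap A B)) :
    ringKrullDim A = ringKrullDim B := by
  apply le_antisymm
  · have : Algebra.HasGoingUp A B := inferInstance
    refine iSup_le fun l => ?_
    obtain ⟨Q, hQ, hc⟩ := Ideal.exists_ideal_over_prime_of_isIntegral_of_isDomain (S := B) l.head.asIdeal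
      (by rw [(RingHom.injective_iff_ker_eq_bot _).1 h]; exact bot_le)
    have : Q.LiesOver l.head.asIdeal := ⟨hc.symm⟩
    obtain ⟨L, hL, -⟩ := Ideal.exists_ltSeries_of_hasGoingUp l Q
    rw [← hL]
    exact le_iSup (fun l : LTSeries (PrimeSpectrum B) => ((l.length : ℕ∞) : WithBot ℕ∞)) L
  · refine Order.krullDim_le_of_strictMono (PrimeSpectrum.comap (algebraMap A B)) ?_
    intro p q hpq
    exact Ideal.IsIntegral.comap_lt_comap (R := A) (I := p.asIdeal) (J := q.asIdeal) hpq

theorem exists_ringKrullDim_eq (k A : Type u) [Field k] [CommRing A] [IsDomain A] [Algebra k A]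
    [Algebra.FiniteType k A] : ∃ s : ℕ, ringKrullDim A = s ∧ Algebra.trdeg k A = s := by
  obtain ⟨s, g, hi, hg⟩ := exists_integral_inj_algHom_of_fg k A
  refine ⟨s, ?_, ?_⟩
  · algebraize [g.toRingHom]
    rw [← ringKrullDim_eq_of_integral_injective (A := MvPolynomial (Fin s) k) (B := A) hi,
      MvPolynomial.ringKrullDim_of_isNoetherianRing]
    simp
  · algebraize [g.toRingHom]
    have : IsScalarTower k (MvPolynomial (Fin s) k) A := .of_algHom g
    have : FaithfulSMul (MvPolynomial (Fin s) k) A := (faithfulSMul_iff_algebraMap_injective _ _).2 hi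
    have h := lift_trdeg_add_eq (R := k) (S := MvPolynomial (Fin s) k) (A := A)
    have h2 : Algebra.trdeg (MvPolynomial (Fin s) k) A = 0 := trdeg_eq_zero
    rw [h2, MvPolynomial.trdeg_of_isDomain] at h
    simpa using h.symm

theorem trdeg_fractionRing (k A K : Type u) [Field k] [CommRing A] [IsDomain A] [Algebra k A]
    [Field K] [Algebra A K] [IsFractionRing A K] [Algebra k K] [IsScalarTower k A K] :
    Algebra.trdeg k K = Algebra.trdeg k A := by
  have : Algebra.IsAlgebraic A K := IsLocalization.isAlgebraic K (nonZeroDivisors A)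
  have : FaithfulSMul k A := inferInstance
  have h := trdeg_add_eq (R := k) (S := A) (A := K)
  rw [← h, show Algebra.trdeg A K = 0 from trdeg_eq_zero, add_zero]

theorem krullDim_le_of_cover {X : Type*} [TopologicalSpace X] (c : WithBot ℕ∞)
    (h : ∀ x : X, ∃ V : Opens X, x ∈ V ∧ topologicalKrullDim V ≤ c) : topologicalKrullDim X ≤ c := by
  refine iSup_le fun l => ?_
  obtain ⟨x, hx⟩ := l.head.isIrreducible.nonempty
  obtain ⟨V, hxV, hV⟩ := h x
  refine le_trans ?_ hV
  have hm (i) : x ∈ l i := (LTSeries.head_le l i) hx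
  let e := IrreducibleCloseds.orderIsoOfIsOpenEmbedding ((↑) : V → X) V.2.isOpenEmbedding_subtypeVal
  let L : LTSeries (IrreducibleCloseds V) :=
    { length := l.length
      toFun i := e.symm ⟨l i, ⟨⟨x, hxV⟩, hm i⟩⟩
      step i := e.symm.strictMono (l.step i) }
  exact le_iSup (fun l : LTSeries (IrreducibleCloseds V) => ((l.length : ℕ∞) : WithBot ℕ∞)) L

theorem krullDim_open_of_integral {k : Type u} [Field k] {X : Scheme.{u}} [IsIntegral X]
    (f : X ⟶ Spec (.of k)) [LocallyOfFiniteType f] (U : X.Opens) (hU : (U : Set X).Nonempty) :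
    topologicalKrullDim U = topologicalKrullDim X := by
  have key : ∃ s : ℕ, ∀ V : X.Opens, IsAffineOpen V → (V : Set X).Nonempty →
      topologicalKrullDim V = s := by
    let φ : CommRingCat.of k ⟶ Γ(X, ⊤) := (Scheme.ΓSpecIso (.of k)).inv ≫ f.appTop
    have aff : ∀ V : X.Opens, IsAffineOpen V → (V : Set X).Nonempty →
      ∃ s : ℕ, topologicalKrullDim V = s ∧
        @Algebra.trdeg k (X.functionField) _ _
          ((φ ≫ X.presheaf.germ ⊤ (genericPoint X) trivial).hom.toAlgebra) = s := by
      intro V hV hne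
      have : Nonempty V := hne.to_subtype
      let i := X.presheaf.map (homOfLE (le_top : V ≤ ⊤)).op
      algebraize [(φ ≫ i).hom, (φ ≫ X.presheaf.germ ⊤ (genericPoint X) trivial).hom]
      have ft : (φ ≫ i).hom.FiniteType := by
        have := LocallyOfFiniteType.finiteType_appLE f (U := ⊤) (isAffineOpen_top _) hV le_top
        have h2 : (φ ≫ i) = (Scheme.ΓSpecIso (.of k)).inv ≫ f.appLE ⊤ V le_top := by
          simp only [φ, i, Scheme.Hom.appLE, Category.assoc]; rfl
        rw [h2, CommRingCat.hom_comp]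
        exact this.comp (RingHom.FiniteType.of_surjective _
          (Scheme.ΓSpecIso (.of k)).commRingCatIsoToRingEquiv.symm.surjective)
      have : Algebra.FiniteType k Γ(X, V) := ft
      obtain ⟨s, h1, h2⟩ := exists_ringKrullDim_eq k Γ(X, V)
      have := functionField_isFractionRing_of_isAffineOpen X V hV
      refine ⟨s, ?_, ?_⟩
      · rw [← h1, ← PrimeSpectrum.topologicalKrullDim_eq_ringKrullDim]
        exact IsHomeomorph.topologicalKrullDim_eq _ (Scheme.homeoOfIso hV.isoSpec).isHomeomorph
      · have : IsScalarTower k Γ(X, V) X.functionField := by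
          refine .of_algebraMap_eq' ?_
          change (φ ≫ X.presheaf.germ ⊤ (genericPoint X) trivial).hom =
            ((φ ≫ i) ≫ X.germToFunctionField V).hom
          congr 1
          simp only [i, Scheme.germToFunctionField, Category.assoc, TopCat.Presheaf.germ_res]
        rw [← h2, trdeg_fractionRing k Γ(X, V) X.functionField]
    obtain ⟨_, ⟨V, hV, rfl⟩, hxV, -⟩ :=
      X.isBasis_affineOpens.exists_subset_of_mem_open (Set.mem_univ (genericPoint X)) isOpen_univ
    obtain ⟨s, -, hs⟩ := aff V hV ⟨_, hxV⟩
    refine ⟨s, fun W hW hW' => ?_⟩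
    obtain ⟨t, ht, ht'⟩ := aff W hW hW'
    rw [ht, Nat.cast_inj.1 (ht'.symm.trans hs)]
  obtain ⟨s, hs⟩ := key
  apply le_antisymm (topologicalKrullDim_subspace_le X U)
  have h1 : topologicalKrullDim X ≤ s := krullDim_le_of_cover _ fun x => by
    obtain ⟨_, ⟨V, hV, rfl⟩, hxV, -⟩ :=
      X.isBasis_affineOpens.exists_subset_of_mem_open (Set.mem_univ x) isOpen_univ
    exact ⟨V, hxV, (hs V hV ⟨x, hxV⟩).le⟩
  obtain ⟨x, hx⟩ := hU
  obtain ⟨_, ⟨V, hV, rfl⟩, hxV, hVU⟩ :=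
      X.isBasis_affineOpens.exists_subset_of_mem_open hx U.2
  refine h1.trans ?_
  rw [← hs V hV ⟨x, hxV⟩]
  exact (Topology.IsEmbedding.inclusion hVU).isInducing.topologicalKrullDim_le

theorem isReduced_vanishingIdeal {X : Scheme.{u}} (Z : Closeds X) :
    IsReduced (Scheme.IdealSheafData.vanishingIdeal Z).subscheme := by
  let I := Scheme.IdealSheafData.vanishingIdeal Z
  have (i : I.subschemeCover.openCover.I₀) : IsReduced (I.subschemeCover.openCover.X i) := by
    change IsReduced (Spec (CommRingCat.of (Γ(X, i.1) ⧸ I.ideal i)))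
    have : _root_.IsReduced (X.presheaf.obj (.op (show X.affineOpens from i).1) ⧸ I.ideal i) := by
      rw [← Ideal.isRadical_iff_quotient_reduced]
      exact PrimeSpectrum.isRadical_vanishingIdeal _
    infer_instance
  exact IsReduced.of_openCover _ I.subschemeCover.openCover

theorem krullDim_preimage {k : Type u} [Field k] {X X' : Scheme.{u}} (f : X ⟶ Spec (.of k))
    [LocallyOfFiniteType f] (j : X' ⟶ X) [IsOpenImmersion j] (Z : IrreducibleCloseds X)
    (h : (j ⁻¹' (Z : Set X)).Nonempty) :
    topologicalKrullDim (j ⁻¹' (Z : Set X)) = topologicalKrullDim (Z : Set X) := by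
  apply le_antisymm
  · exact (j.isOpenEmbedding.isInducing.restrictPreimage (Z : Set X)).topologicalKrullDim_le
  let I := Scheme.IdealSheafData.vanishingIdeal ⟨(Z : Set X), Z.isClosed⟩
  have hr : Set.range I.subschemeι = (Z : Set X) := by
    rw [Scheme.IdealSheafData.range_subschemeι]; rfl
  let e : I.subscheme ≃ₜ (Z : Set X) :=
    I.subschemeι.isEmbedding.toHomeomorph.trans (Homeomorph.setCongr hr)
  have : IsReduced I.subscheme := isReduced_vanishingIdeal _
  have hZ : IrreducibleSpace (Z : Set X) := Subtype.irreducibleSpace Z.isIrreducible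
  have : IrreducibleSpace I.subscheme := e.symm.surjective.irreducibleSpace e.symm.continuous
  have : IsIntegral I.subscheme := isIntegral_of_irreducibleSpace_of_isReduced _
  let U : I.subscheme.Opens := I.subschemeι ⁻¹ᵁ j.opensRange
  obtain ⟨x, hx⟩ := h
  have hU : (U : Set I.subscheme).Nonempty := by
    obtain ⟨y, hy⟩ := hr.ge hx
    exact ⟨y, x, hy.symm⟩
  have h1 := krullDim_open_of_integral (I.subschemeι ≫ f) U hU
  rw [← e.isHomeomorph.topologicalKrullDim_eq, ← h1]
  have hU' (y : U) : I.subschemeι y.1 ∈ Set.range j := y.2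
  let g : U → X' := fun y => j.isOpenEmbedding.isEmbedding.toHomeomorph.symm ⟨_, hU' y⟩
  have hg : ∀ y, j (g y) = I.subschemeι y.1 := fun y =>
    congrArg Subtype.val (j.isOpenEmbedding.isEmbedding.toHomeomorph.apply_symm_apply ⟨_, hU' y⟩)
  have hgi : Topology.IsInducing g := by
    refine .of_comp ?_ j.continuous ?_
    · exact j.isOpenEmbedding.isEmbedding.toHomeomorph.symm.continuous.comp
        ((I.subschemeι.continuous.comp continuous_subtype_val).subtype_mk _)
    · have hc : j ∘ g = fun y : U => I.subschemeι y.1 := funext hg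
      rw [hc]
      exact I.subschemeι.isEmbedding.isInducing.comp .subtypeVal
  have hgm (y) : g y ∈ j ⁻¹' (Z : Set X) := by
    change j (g y) ∈ (Z : Set X)
    rw [hg, ← hr]; exact ⟨_, rfl⟩
  exact (hgi.codRestrict hgm).topologicalKrullDim_le

/-! The cubes, admissible cycles, and the presheaf. -/

/-- The standard grading of `k[X₀, X₁]`. -/
abbrev stdGrading (k : Type u) [Field k] : ℕ → Submodule k (MvPolynomial (Fin 2) k) :=
  MvPolynomial.homogeneousSubmodule (Fin 2) k

noncomputable instance stdGradedAlgebra (k : Type u) [Field k] : GradedAlgebra (stdGrading k) :=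
  MvPolynomial.gradedAlgebra

/-- The structure morphism of the projective line `ℙ¹ = Proj k[X₀, X₁]` over `k`. -/
noncomputable def projLineStr (k : Type u) [Field k] : Proj (stdGrading k) ⟶ Spec (.of k) :=
  Proj.toSpecZero (stdGrading k) ≫
    Spec.map (CommRingCat.ofHom (algebraMap k (stdGrading k 0)))

/-- `□ = ℙ¹ ∖ {1}`, where the coordinate of `ℙ¹` is `y = X₀ / X₁`, so that `y = 1` is the
vanishing locus of `X₀ - X₁`. -/
noncomputable def box (k : Type u) [Field k] : (Proj (stdGrading k)).Opens :=
  Proj.basicOpen (stdGrading k) (MvPolynomial.X 0 - MvPolynomial.X 1)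

/-- The structure morphism of `□` over `k`. -/
noncomputable def boxStr (k : Type u) [Field k] : (box k).toScheme ⟶ Spec (.of k) :=
  (box k).ι ≫ projLineStr k

/-- The closed point `y = 0` (for `e = 0`, i.e. `X₀ = 0`) or `y = ∞` (for `e = 1`, i.e. `X₁ = 0`)
of `□`. -/
def boxEnd (k : Type u) [Field k] (e : Fin 2) : Set (box k).toScheme :=
  {p | (MvPolynomial.X e : MvPolynomial (Fin 2) k) ∈
    ProjectiveSpectrum.asHomogeneousIdeal ((box k).ι p)}

/-- `□ⁿ`, the `n`-fold fibre product of `□` over `k`; for `n = 0` it is `Spec k`. -/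
noncomputable abbrev cube (k : Type u) [Field k] (n : ℕ) : Scheme.{u} :=
  widePullback (Spec (.of k)) (fun _ : Fin n => (box k).toScheme) (fun _ => boxStr k)

/-- The structure morphism of `□ⁿ` over `k`. -/
noncomputable abbrev cubeStr (k : Type u) [Field k] (n : ℕ) : cube k n ⟶ Spec (.of k) :=
  WidePullback.base (fun _ : Fin n => boxStr k)

/-- `□ⁿ_Y = Y ×ₖ □ⁿ` for a `k`-scheme `f : Y ⟶ Spec k`. -/
noncomputable abbrev cubeOver {k : Type u} [Field k] {Y : Scheme.{u}} (f : Y ⟶ Spec (.of k))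
    (n : ℕ) : Scheme.{u} :=
  pullback f (cubeStr k n)

/-- The structure morphism of `□ⁿ_Y` over `k`. -/
noncomputable abbrev cubeOverStr {k : Type u} [Field k] {Y : Scheme.{u}} (f : Y ⟶ Spec (.of k))
    (n : ℕ) : cubeOver f n ⟶ Spec (.of k) :=
  pullback.fst f (cubeStr k n) ≫ f

/-- The coordinate `yᵢ : □ⁿ_Y ⟶ □`. -/
noncomputable def cubeCoord {k : Type u} [Field k] {Y : Scheme.{u}} (f : Y ⟶ Spec (.of k))
    (n : ℕ) (i : Fin n) : cubeOver f n ⟶ (box k).toScheme :=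
  pullback.snd f (cubeStr k n) ≫ WidePullback.π (fun _ : Fin n => boxStr k) i

/-- (The underlying closed subset of) the face `Y × F` of `□ⁿ_Y`, where `F` is given by the
equations `yᵢ = εᵢ` for `i ∈ s`; it has codimension `s.card`. -/
def cubeFace {k : Type u} [Field k] {Y : Scheme.{u}} (f : Y ⟶ Spec (.of k))
    (n : ℕ) (s : Finset (Fin n)) (ε : Fin n → Fin 2) : Set (cubeOver f n) :=
  {x | ∀ i ∈ s, cubeCoord f n i x ∈ boxEnd k (ε i)}

/-- The projection `□ⁿ⁺¹_Y ⟶ □ⁿ_Y` that forgets the `i`-th coordinate. -/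
noncomputable def cubeForget {k : Type u} [Field k] {Y : Scheme.{u}} (f : Y ⟶ Spec (.of k))
    (n : ℕ) (i : Fin (n + 1)) : cubeOver f (n + 1) ⟶ cubeOver f n :=
  pullback.map f (cubeStr k (n + 1)) f (cubeStr k n) (𝟙 Y)
    (WidePullback.lift (cubeStr k (n + 1))
      (fun j => WidePullback.π (fun _ : Fin (n + 1) => boxStr k) (i.succAbove j))
      (fun j => WidePullback.π_arrow (fun _ : Fin (n + 1) => boxStr k) (i.succAbove j)))
    (𝟙 _) (by simp) (by rw [Category.comp_id, WidePullback.lift_base])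

/-- The base change `□ⁿ_{Y'} ⟶ □ⁿ_Y` of a morphism `j : Y' ⟶ Y` of `k`-schemes. -/
noncomputable def cubeMap {k : Type u} [Field k] {Y Y' : Scheme.{u}} (f : Y ⟶ Spec (.of k))
    (f' : Y' ⟶ Spec (.of k)) (j : Y' ⟶ Y) (h : j ≫ f = f') (n : ℕ) :
    cubeOver f' n ⟶ cubeOver f n :=
  pullback.map f' (cubeStr k n) f (cubeStr k n) j (𝟙 _) (𝟙 _) (by simp [h]) (by simp)

instance cubeMap_isOpenImmersion {k : Type u} [Field k] {Y Y' : Scheme.{u}} (f : Y ⟶ Spec (.of k))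
    (f' : Y' ⟶ Spec (.of k)) (j : Y' ⟶ Y) (h : j ≫ f = f') (n : ℕ) [IsOpenImmersion j] :
    IsOpenImmersion (cubeMap f f' j h n) := by
  unfold cubeMap; infer_instance

theorem cubeMap_fst {k : Type u} [Field k] {Y Y' : Scheme.{u}} (f : Y ⟶ Spec (.of k))
    (f' : Y' ⟶ Spec (.of k)) (j : Y' ⟶ Y) (h : j ≫ f = f') (n : ℕ) :
    cubeMap f f' j h n ≫ pullback.fst f (cubeStr k n) = pullback.fst f' (cubeStr k n) ≫ j :=
  pullback.lift_fst _ _ _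

theorem cubeMap_snd {k : Type u} [Field k] {Y Y' : Scheme.{u}} (f : Y ⟶ Spec (.of k))
    (f' : Y' ⟶ Spec (.of k)) (j : Y' ⟶ Y) (h : j ≫ f = f') (n : ℕ) :
    cubeMap f f' j h n ≫ pullback.snd f (cubeStr k n) = pullback.snd f' (cubeStr k n) :=
  (pullback.lift_snd _ _ _).trans (Category.comp_id _)

theorem cubeForget_fst {k : Type u} [Field k] {Y : Scheme.{u}} (f : Y ⟶ Spec (.of k))
    (n : ℕ) (i : Fin (n + 1)) :
    cubeForget f n i ≫ pullback.fst f (cubeStr k n) = pullback.fst f (cubeStr k (n + 1)) :=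
  (pullback.lift_fst _ _ _).trans (Category.comp_id _)

theorem cubeForget_snd {k : Type u} [Field k] {Y : Scheme.{u}} (f : Y ⟶ Spec (.of k))
    (n : ℕ) (i : Fin (n + 1)) :
    cubeForget f n i ≫ pullback.snd f (cubeStr k n) = pullback.snd f (cubeStr k (n + 1)) ≫
      WidePullback.lift (cubeStr k (n + 1))
        (fun j => WidePullback.π (fun _ : Fin (n + 1) => boxStr k) (i.succAbove j))
        (fun j => WidePullback.π_arrow (fun _ : Fin (n + 1) => boxStr k) (i.succAbove j)) :=
  pullback.lift_snd _ _ _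

theorem cubeForget_coord {k : Type u} [Field k] {Y : Scheme.{u}} (f : Y ⟶ Spec (.of k))
    (n : ℕ) (i : Fin (n + 1)) (j : Fin n) :
    cubeForget f n i ≫ cubeCoord f n j = cubeCoord f (n + 1) (i.succAbove j) := by
  rw [cubeCoord, cubeCoord, ← Category.assoc, cubeForget_snd, Category.assoc, WidePullback.lift_π]

theorem cubeMap_coord {k : Type u} [Field k] {Y Y' : Scheme.{u}} (f : Y ⟶ Spec (.of k))
    (f' : Y' ⟶ Spec (.of k)) (j : Y' ⟶ Y) (h : j ≫ f = f') (n : ℕ) (i : Fin n) :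
    cubeMap f f' j h n ≫ cubeCoord f n i = cubeCoord f' n i := by
  rw [cubeCoord, cubeCoord, ← Category.assoc, cubeMap_snd]

theorem cubeMap_forget {k : Type u} [Field k] {Y Y' : Scheme.{u}} (f : Y ⟶ Spec (.of k))
    (f' : Y' ⟶ Spec (.of k)) (j : Y' ⟶ Y) (h : j ≫ f = f') (n : ℕ) (i : Fin (n + 1)) :
    cubeMap f f' j h (n + 1) ≫ cubeForget f n i = cubeForget f' n i ≫ cubeMap f f' j h n := by
  apply pullback.hom_ext
  · rw [Category.assoc, Category.assoc, cubeForget_fst, cubeMap_fst, cubeMap_fst,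
      ← Category.assoc, cubeForget_fst]
  · rw [Category.assoc, Category.assoc, cubeForget_snd, cubeMap_snd, ← Category.assoc,
      cubeMap_snd, cubeForget_snd]

theorem cubeMap_comp {k : Type u} [Field k] {Y Y' Y'' : Scheme.{u}} (f : Y ⟶ Spec (.of k))
    (f' : Y' ⟶ Spec (.of k)) (f'' : Y'' ⟶ Spec (.of k)) (j : Y' ⟶ Y) (j' : Y'' ⟶ Y')
    (h : j ≫ f = f') (h' : j' ≫ f' = f'') (h'' : (j' ≫ j) ≫ f = f'') (n : ℕ) :
    cubeMap f f'' (j' ≫ j) h'' n = cubeMap f' f'' j' h' n ≫ cubeMap f f' j h n := by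
  apply pullback.hom_ext
  · rw [Category.assoc, cubeMap_fst, cubeMap_fst, ← Category.assoc, ← Category.assoc, cubeMap_fst]
  · rw [Category.assoc, cubeMap_snd, cubeMap_snd, cubeMap_snd]

theorem cubeMap_face {k : Type u} [Field k] {Y Y' : Scheme.{u}} (f : Y ⟶ Spec (.of k))
    (f' : Y' ⟶ Spec (.of k)) (j : Y' ⟶ Y) (h : j ≫ f = f') (n : ℕ) (s : Finset (Fin n))
    (ε : Fin n → Fin 2) :
    cubeMap f f' j h n ⁻¹' cubeFace f n s ε = cubeFace f' n s ε := by
  ext x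
  simp only [cubeFace, Set.mem_preimage, Set.mem_ofPred_eq]
  refine forall₂_congr fun i _ => ?_
  rw [← cubeMap_coord f f' j h n]; rfl

instance boxStr_locallyOfFiniteType (k : Type u) [Field k] : LocallyOfFiniteType (boxStr k) := by
  have h1 : Function.Surjective (algebraMap k (stdGrading k 0)) := by
    rintro ⟨p, hp⟩
    refine ⟨p.coeff 0, Subtype.ext ?_⟩
    have := (MvPolynomial.totalDegree_eq_zero_iff_eq_C (p := p)).1
      (Nat.le_zero.1 (((MvPolynomial.mem_homogeneousSubmodule 0 p).1 hp).totalDegree_le))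
    exact this.symm
  have h2 : Algebra.FiniteType (stdGrading k 0) (MvPolynomial (Fin 2) k) := by
    have : IsScalarTower k (stdGrading k 0) (MvPolynomial (Fin 2) k) :=
      IsScalarTower.of_algebraMap_eq (R := k) (S := stdGrading k 0) (A := MvPolynomial (Fin 2) k)
        (fun _ => rfl)
    exact Algebra.FiniteType.of_restrictScalars_finiteType k _ _
  have h3 : LocallyOfFiniteType
      (Spec.map (CommRingCat.ofHom (algebraMap k (stdGrading k 0)))) := by
    rw [HasRingHomProperty.Spec_iff (P := @LocallyOfFiniteType)]
    exact RingHom.FiniteType.of_surjective _ h1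
  unfold boxStr projLineStr
  infer_instance

instance cubeStr_locallyOfFiniteType (k : Type u) [Field k] (n : ℕ) :
    LocallyOfFiniteType (cubeStr k n) := by
  induction n with
  | zero =>
    have : IsIso (cubeStr k 0) := by
      refine ⟨WidePullback.lift (𝟙 _) (fun i => i.elim0) (fun i => i.elim0), ?_, ?_⟩
      · apply WidePullback.hom_ext
        · exact fun i => i.elim0
        · rw [Category.assoc, WidePullback.lift_base, Category.comp_id, Category.id_comp]
      · rw [WidePullback.lift_base]
    infer_instance
  | succ n ih =>
    have ha : WidePullback.π (fun _ : Fin (n + 1) => boxStr k) 0 ≫ boxStr k =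
        WidePullback.lift (cubeStr k (n + 1))
          (fun j => WidePullback.π (fun _ : Fin (n + 1) => boxStr k) j.succ)
          (fun j => WidePullback.π_arrow (fun _ : Fin (n + 1) => boxStr k) j.succ) ≫
            cubeStr k n := by
      rw [WidePullback.lift_base]
      exact WidePullback.π_arrow (fun _ : Fin (n + 1) => boxStr k) 0
    let a : cube k (n + 1) ⟶ pullback (boxStr k) (cubeStr k n) := pullback.lift _ _ ha
    have ha1 : a ≫ pullback.fst _ _ = WidePullback.π (fun _ : Fin (n + 1) => boxStr k) 0 :=
      pullback.lift_fst _ _ _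
    have ha2 : a ≫ pullback.snd _ _ = _ := pullback.lift_snd _ _ ha
    have hb : ∀ j : Fin (n + 1), Fin.cons (α := fun _ => pullback (boxStr k) (cubeStr k n) ⟶
        (box k).toScheme) (pullback.fst _ _)
        (fun j => pullback.snd _ _ ≫ WidePullback.π (fun _ : Fin n => boxStr k) j) j ≫ boxStr k =
        pullback.fst _ _ ≫ boxStr k := by
      intro j
      refine Fin.cases ?_ (fun j => ?_) j
      · rw [Fin.cons_zero]
      · rw [Fin.cons_succ, Category.assoc, WidePullback.π_arrow (fun _ : Fin n => boxStr k) j,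
          pullback.condition]
    let b : pullback (boxStr k) (cubeStr k n) ⟶ cube k (n + 1) := WidePullback.lift _ _ hb
    have hb1 (j) : b ≫ WidePullback.π (fun _ : Fin (n + 1) => boxStr k) j = _ :=
      WidePullback.lift_π _ _ _ hb j
    have hb2 : b ≫ cubeStr k (n + 1) = pullback.fst _ _ ≫ boxStr k :=
      WidePullback.lift_base _ _ _ hb
    have hab : a ≫ b = 𝟙 _ := by
      apply WidePullback.hom_ext
      · intro j
        rw [Category.assoc, hb1, Category.id_comp]
        refine Fin.cases ?_ (fun j => ?_) j
        · rw [Fin.cons_zero, ha1]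
        · rw [Fin.cons_succ, ← Category.assoc, ha2, WidePullback.lift_π]
      · rw [Category.assoc, hb2, ← Category.assoc, ha1, Category.id_comp]
        exact WidePullback.π_arrow (fun _ : Fin (n + 1) => boxStr k) 0
    have hba : b ≫ a = 𝟙 _ := by
      apply pullback.hom_ext
      · rw [Category.assoc, ha1, hb1, Fin.cons_zero, Category.id_comp]
      · rw [Category.assoc, ha2, Category.id_comp]
        apply WidePullback.hom_ext
        · intro j
          rw [Category.assoc, WidePullback.lift_π, hb1, Fin.cons_succ]
        · rw [Category.assoc, WidePullback.lift_base, hb2, pullback.condition]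
    have : IsIso a := ⟨b, hab, hba⟩
    have h : cubeStr k (n + 1) = a ≫ pullback.fst _ _ ≫ boxStr k := by
      rw [← Category.assoc, ha1]
      exact (WidePullback.π_arrow (fun _ : Fin (n + 1) => boxStr k) 0).symm
    rw [h]
    infer_instance

/-- An integral closed subscheme `Z` of `□ⁿ_Y` (given by its underlying irreducible closed subset)
is admissible if it has dimension `d + n` and intersects all faces properly: as `Y × F` is locally
cut out by `codim F` equations, this means that `dim (Z ∩ (Y × F)) ≤ dim Z - codim F`. Here
dimension is Krull dimension, and the empty set has dimension `-∞`. -/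
structure IsAdmissible {k : Type u} [Field k] {Y : Scheme.{u}} (f : Y ⟶ Spec (.of k))
    (d : ℤ) (n : ℕ) (Z : IrreducibleCloseds (cubeOver f n)) : Prop where
  dim_eq : ∃ r : ℕ, (r : ℤ) = d + n ∧ topologicalKrullDim (Z : Set (cubeOver f n)) = r
  proper : ∀ (s : Finset (Fin n)) (ε : Fin n → Fin 2),
    topologicalKrullDim ((Z : Set (cubeOver f n)) ∩ cubeFace f n s ε : Set (cubeOver f n)) +
      (s.card : WithBot ℕ∞) ≤ topologicalKrullDim (Z : Set (cubeOver f n))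

/-- The admissible integral closed subschemes of `□ⁿ_Y` of dimension `d + n`. -/
def Admissible {k : Type u} [Field k] {Y : Scheme.{u}} (f : Y ⟶ Spec (.of k))
    (d : ℤ) (n : ℕ) : Type u :=
  {Z : IrreducibleCloseds (cubeOver f n) // IsAdmissible f d n Z}

/-- The group `z̲_d(Y, n)` of admissible cycles. -/
abbrev AdmCycles {k : Type u} [Field k] {Y : Scheme.{u}} (f : Y ⟶ Spec (.of k))
    (d : ℤ) (n : ℕ) : Type u :=
  Admissible f d n →₀ ℤ

/-- `Z` is the pull-back of an admissible integral cycle `Z'` along a projection that forgets one of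
the coordinates. (As `□` is smooth and geometrically integral over `k`, the inverse image of `Z'` is
integral, so that the flat pull-back of the cycle `Z'` is this inverse image.) -/
def IsDegenerate {k : Type u} [Field k] {Y : Scheme.{u}} (f : Y ⟶ Spec (.of k)) (d : ℤ) :
    (n : ℕ) → Admissible f d n → Prop
  | 0, _ => False
  | n + 1, Z => ∃ (i : Fin (n + 1)) (Z' : Admissible f d n),
      (Z.1 : Set (cubeOver f (n + 1))) = cubeForget f n i ⁻¹' (Z'.1 : Set (cubeOver f n))

/-- The subgroup `z̲_d(Y, n)_degn` of degenerate cycles. -/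
noncomputable def degnCycles {k : Type u} [Field k] {Y : Scheme.{u}} (f : Y ⟶ Spec (.of k))
    (d : ℤ) (n : ℕ) : AddSubgroup (AdmCycles f d n) :=
  AddSubgroup.closure {x | ∃ Z, IsDegenerate f d n Z ∧ x = Finsupp.single Z 1}

/-- The group `z_d(Y, n) = z̲_d(Y, n) / z̲_d(Y, n)_degn` in degree `n` of the cubical higher Chow
complex. -/
abbrev HigherCycles {k : Type u} [Field k] {Y : Scheme.{u}} (f : Y ⟶ Spec (.of k))
    (d : ℤ) (n : ℕ) : Type u :=
  AdmCycles f d n ⧸ degnCycles f d n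

section Restriction

variable {k : Type u} [Field k] {Y Y' : Scheme.{u}} (f : Y ⟶ Spec (.of k))
    (f' : Y' ⟶ Spec (.of k)) (j : Y' ⟶ Y) [IsOpenImmersion j] (h : j ≫ f = f')
    [LocallyOfFiniteType f]

/-- The restriction of an admissible `Z`, meeting `□ⁿ_{Y'}`, to the open subscheme `□ⁿ_{Y'}`. -/
def Admissible.restrict {d : ℤ} {n : ℕ} (Z : Admissible f d n)
    (hZ : (cubeMap f f' j h n ⁻¹' (Z.1 : Set (cubeOver f n))).Nonempty) : Admissible f' d n :=
  ⟨{ carrier := cubeMap f f' j h n ⁻¹' (Z.1 : Set (cubeOver f n))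
     isIrreducible' := ⟨hZ, Z.1.isIrreducible.isPreirreducible.preimage
       (cubeMap f f' j h n).isOpenEmbedding⟩
     isClosed' := Z.1.isClosed.preimage (cubeMap f f' j h n).continuous },
   { dim_eq := by
       obtain ⟨r, hr, hr'⟩ := Z.2.dim_eq
       exact ⟨r, hr, (krullDim_preimage (cubeOverStr f n) (cubeMap f f' j h n) Z.1 hZ).trans hr'⟩
     proper := fun s ε => by
       refine le_trans ?_ ((Z.2.proper s ε).trans
         (krullDim_preimage (cubeOverStr f n) (cubeMap f f' j h n) Z.1 hZ).ge)
       gcongr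
       have := ((cubeMap f f' j h n).isOpenEmbedding.isInducing.restrictPreimage
         ((Z.1 : Set (cubeOver f n)) ∩ cubeFace f n s ε)).topologicalKrullDim_le
       rw [Set.preimage_inter, cubeMap_face] at this
       exact this }⟩

open Classical in
/-- The restriction of cycles `z̲_d(Y, n) → z̲_d(Y', n)` along an open immersion `j : Y' ⟶ Y`:
it sends `Z` to `Z ∩ □ⁿ_{Y'}` if this is non-empty, and to `0` otherwise. -/
noncomputable def admRestrict (d : ℤ) (n : ℕ) : AdmCycles f d n →+ AdmCycles f' d n :=
  Finsupp.liftAddHom fun Z =>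
    if hZ : (cubeMap f f' j h n ⁻¹' (Z.1 : Set (cubeOver f n))).Nonempty then
      Finsupp.singleAddHom (Z.restrict f f' j h hZ) else 0

theorem degnCycles_le_comap (d : ℤ) (n : ℕ) :
    degnCycles f d n ≤ (degnCycles f' d n).comap (admRestrict f f' j h d n) := by
  rw [degnCycles, AddSubgroup.closure_le]
  rintro _ ⟨Z, hZ, rfl⟩
  simp only [admRestrict, AddSubgroup.coe_comap, Set.mem_preimage, Finsupp.liftAddHom_apply_single]
  split_ifs with hne
  · refine AddSubgroup.subset_closure ⟨_, ?_, rfl⟩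
    match n, Z, hZ with
    | n + 1, Z, ⟨i, Z', hZ'⟩ =>
      have e : cubeMap f f' j h (n + 1) ⁻¹' (Z.1 : Set (cubeOver f (n + 1))) =
          cubeForget f' n i ⁻¹' (cubeMap f f' j h n ⁻¹' (Z'.1 : Set (cubeOver f n))) := by
        rw [hZ', ← Set.preimage_comp, ← Set.preimage_comp]
        exact congrArg (fun g : cubeOver f' (n + 1) ⟶ cubeOver f n =>
          g ⁻¹' (Z'.1 : Set (cubeOver f n))) (cubeMap_forget f f' j h n i)
      refine ⟨i, Z'.restrict f f' j h ?_, e⟩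
      obtain ⟨x, hx⟩ := hne
      exact ⟨_, e.le hx⟩
  · exact zero_mem _

/-- The flat restriction map `ρ : z_d(Y, n) → z_d(Y', n)` along an open immersion `j : Y' ⟶ Y`. -/
noncomputable def higherRestrict (d : ℤ) (n : ℕ) : HigherCycles f d n →+ HigherCycles f' d n :=
  QuotientAddGroup.map _ _ (admRestrict f f' j h d n) (degnCycles_le_comap f f' j h d n)

theorem higherRestrict_comp {Y'' : Scheme.{u}} (f'' : Y'' ⟶ Spec (.of k)) (j' : Y'' ⟶ Y')
    [IsOpenImmersion j'] (h' : j' ≫ f' = f'') [LocallyOfFiniteType f'] (j'' : Y'' ⟶ Y)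
    [IsOpenImmersion j''] (e : j'' = j' ≫ j) (h'' : j'' ≫ f = f'') (d : ℤ) (n : ℕ) :
    higherRestrict f f'' j'' h'' d n =
      (higherRestrict f' f'' j' h' d n).comp (higherRestrict f f' j h d n) := by
  subst e
  have key : admRestrict f f'' (j' ≫ j) h'' d n =
      (admRestrict f' f'' j' h' d n).comp (admRestrict f f' j h d n) := by
    refine Finsupp.addHom_ext' fun Z => ?_
    ext1
    have e : cubeMap f f'' (j' ≫ j) h'' n ⁻¹' (Z.1 : Set (cubeOver f n)) =
        cubeMap f' f'' j' h' n ⁻¹' (cubeMap f f' j h n ⁻¹' (Z.1 : Set (cubeOver f n))) := by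
      rw [cubeMap_comp f f' f'' j j' h h' h'' n]; rfl
    by_cases h1 : (cubeMap f f' j h n ⁻¹' (Z.1 : Set (cubeOver f n))).Nonempty
    · by_cases h2 : (cubeMap f f'' (j' ≫ j) h'' n ⁻¹' (Z.1 : Set (cubeOver f n))).Nonempty
      · have h3 : (cubeMap f' f'' j' h' n ⁻¹'
          ((Z.restrict f f' j h h1).1 : Set (cubeOver f' n))).Nonempty := by
          rw [e] at h2; exact h2
        simp only [admRestrict, AddMonoidHom.comp_apply, Finsupp.singleAddHom_apply,
          Finsupp.liftAddHom_apply_single, h1, h2, h3, dite_true]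
        congr 1
        exact Subtype.ext (IrreducibleCloseds.ext e)
      · have h3 : ¬ (cubeMap f' f'' j' h' n ⁻¹'
          ((Z.restrict f f' j h h1).1 : Set (cubeOver f' n))).Nonempty := by
          rw [e] at h2; exact h2
        simp only [admRestrict, AddMonoidHom.comp_apply, Finsupp.singleAddHom_apply,
          Finsupp.liftAddHom_apply_single, h1, h2, h3, dite_true, dite_false]
    · have h2 : ¬ (cubeMap f f'' (j' ≫ j) h'' n ⁻¹' (Z.1 : Set (cubeOver f n))).Nonempty := by
        rw [e]; rintro ⟨x, hx⟩; exact h1 ⟨_, hx⟩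
      simp only [admRestrict, AddMonoidHom.comp_apply, Finsupp.singleAddHom_apply,
          Finsupp.liftAddHom_apply_single, h1, h2, dite_false]
      simp
  refine QuotientAddGroup.addMonoidHom_ext _ (AddMonoidHom.ext fun x => ?_)
  change QuotientAddGroup.mk _ = QuotientAddGroup.mk _
  rw [key]; rfl

end Restriction

/-- `G_d(W, n) = ker (z_d(Y, n) → z_d(Y ∖ W, n))` for a closed subset `W` of `Y`: the cycles
supported over `W`. -/
noncomputable def supportedCycles {k : Type u} [Field k] {Y : Scheme.{u}} (f : Y ⟶ Spec (.of k))
    [LocallyOfFiniteType f] (d : ℤ) (n : ℕ) (W : Closeds Y) : AddSubgroup (HigherCycles f d n) :=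
  (higherRestrict f (Scheme.Opens.ι W.compl ≫ f) (Scheme.Opens.ι W.compl) rfl d n).ker

theorem supportedCycles_mono {k : Type u} [Field k] {Y : Scheme.{u}} (f : Y ⟶ Spec (.of k))
    [LocallyOfFiniteType f] (d : ℤ) (n : ℕ) {W₁ W₂ : Closeds Y} (hW : W₁ ≤ W₂) :
    supportedCycles f d n W₁ ≤ supportedCycles f d n W₂ := by
  intro x hx
  have hle : (W₂.compl : Y.Opens) ≤ W₁.compl := fun y hy hy' => hy (hW hy')
  rw [supportedCycles, AddMonoidHom.mem_ker] at hx ⊢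
  rw [higherRestrict_comp f (Scheme.Opens.ι W₁.compl ≫ f) (Scheme.Opens.ι W₁.compl) rfl
    (Scheme.Opens.ι W₂.compl ≫ f) (Y.homOfLE hle) (by simp) _ (by simp),
    AddMonoidHom.comp_apply, hx, map_zero]

/-- The presheaf `U ↦ A / G(U)` for a family of subgroups `G(U)` of an abelian group `A`, increasing
as `U` shrinks; its restriction maps are the natural quotient maps. -/
noncomputable def quotientPresheaf {X : TopCat.{u}} (A : Type u) [AddCommGroup A]
    (G : Opens X → AddSubgroup A) (hG : ∀ U V, V ≤ U → G U ≤ G V) :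
    TopCat.Presheaf AddCommGrpCat.{u} X where
  obj U := .of (A ⧸ G U.unop)
  map {U V} i := AddCommGrpCat.ofHom
    (QuotientAddGroup.map (G U.unop) (G V.unop) (AddMonoidHom.id A) (hG _ _ i.unop.le))
  map_id U := by
    refine AddCommGrpCat.hom_ext (AddMonoidHom.ext fun x => ?_)
    obtain ⟨x, rfl⟩ := QuotientAddGroup.mk_surjective x
    rfl
  map_comp {U V W} i i' := by
    refine AddCommGrpCat.hom_ext (AddMonoidHom.ext fun x => ?_)
    obtain ⟨x, rfl⟩ := QuotientAddGroup.mk_surjective x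
    rfl

/-- The presheaf `𝒮_{n,d} : U ↦ z_d(Y, n) / G_d(Y ∖ U, n)` on `Y`. -/
noncomputable def cyclePresheaf {k : Type u} [Field k] {Y : Scheme.{u}} (f : Y ⟶ Spec (.of k))
    [LocallyOfFiniteType f] (d : ℤ) (n : ℕ) : TopCat.Presheaf AddCommGrpCat.{u} Y.carrier :=
  quotientPresheaf (HigherCycles f d n) (fun U => supportedCycles f d n U.compl)
    (fun _ _ h => supportedCycles_mono f d n (fun _ hy hy' => hy (h hy')))

/-- `δ₀ : F(U ∪ V) → F(U) ⊕ F(V)`, `x ↦ (x|_U, x|_V)`. -/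
noncomputable def mayerVietorisZero {X : TopCat.{u}} (F : TopCat.Presheaf AddCommGrpCat.{u} X)
    (U V : Opens X) : F.obj (.op (U ⊔ V)) →+ F.obj (.op U) × F.obj (.op V) :=
  (F.map (homOfLE le_sup_left).op).hom.prod (F.map (homOfLE le_sup_right).op).hom

/-- `δ₁ : F(U) ⊕ F(V) → F(U ∩ V)`, `(x₁, x₂) ↦ x₁|_{U ∩ V} - x₂|_{U ∩ V}`. -/
noncomputable def mayerVietorisOne {X : TopCat.{u}} (F : TopCat.Presheaf AddCommGrpCat.{u} X)
    (U V : Opens X) : F.obj (.op U) × F.obj (.op V) →+ F.obj (.op (U ⊓ V)) :=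
  (F.map (homOfLE inf_le_left).op).hom.comp (AddMonoidHom.fst _ _) -
    (F.map (homOfLE inf_le_right).op).hom.comp (AddMonoidHom.snd _ _)

/-!
Let `G(U) ⊆ z_d(Y, n)` be the cycles supported over `Y ∖ U`. If `G` turns unions of opens into
intersections of subgroups and intersections into sums, then `U ↦ z_d(Y, n) / G(U)` is a sheaf by
the argument of the Chinese remainder theorem, which needs only finitely many opens because `Y` is
Noetherian; flasqueness is immediate, and a flasque sheaf has exact Mayer–Vietoris sequences.

Modulo degenerate cycles, `G_d(W, n)` is spanned by the irreducible cycles lying over `W`: an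
irreducible cycle over `W₁ ∪ W₂` lies over `W₁` or over `W₂`, whence the two properties of `G`.
This description of `G_d(W, n)` requires that an irreducible cycle `Z` whose restriction to an open
subscheme is non-zero and degenerate is itself degenerate. If the restriction is the pull-back of
`B` along the projection forgetting `yᵢ`, then `Z` is the pull-back of the closure `C` of `B`. That
`C` meets the faces properly follows from the same property of `Z` for the faces on which `yᵢ = 0`.
-/

section CongruenceGluing

theorem mem_finset_sup_iff {A L ι : Type*} [AddGroup A] [SemilatticeSup L] [OrderBot L]
    {G : L → AddSubgroup A} {U : ι → L} (hbot : G ⊥ = ⊤) (hsup : ∀ U V, G (U ⊔ V) = G U ⊓ G V)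
    {t : Finset ι} {x : A} : x ∈ G (t.sup U) ↔ ∀ i ∈ t, x ∈ G (U i) := by
  induction t using Finset.cons_induction with
  | empty => simp [hbot]
  | cons m t _ ih => rw [Finset.sup_cons, hsup, AddSubgroup.mem_inf, ih, Finset.forall_mem_cons]

variable {A L ι : Type*} [AddCommGroup A] [DistribLattice L] [OrderBot L] {G : L → AddSubgroup A}
  {U : ι → L}

theorem sub_mem_finset_sup_inf (hbot : G ⊥ = ⊤) (hsup : ∀ U V, G (U ⊔ V) = G U ⊓ G V)
    (hinf : ∀ U V, G (U ⊓ V) = G U ⊔ G V) {a : ι → A} (ha : ∀ i j, a i - a j ∈ G (U i ⊓ U j))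
    {t : Finset ι} {x : A} (hx : ∀ i ∈ t, x - a i ∈ G (U i)) (m : ι) :
    x - a m ∈ G (t.sup U ⊓ U m) := by
  rw [Finset.sup_inf_distrib_right, mem_finset_sup_iff hbot hsup]
  intro i hi
  rw [← sub_add_sub_cancel x (a i), hinf]
  exact add_mem (AddSubgroup.mem_sup_left (hx i hi)) (hinf _ _ ▸ ha i m)

theorem exists_forall_sub_mem (hbot : G ⊥ = ⊤) (hsup : ∀ U V, G (U ⊔ V) = G U ⊓ G V)
    (hinf : ∀ U V, G (U ⊓ V) = G U ⊔ G V) {a : ι → A} (ha : ∀ i j, a i - a j ∈ G (U i ⊓ U j))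
    (t : Finset ι) : ∃ x, ∀ i ∈ t, x - a i ∈ G (U i) := by
  induction t using Finset.cons_induction with
  | empty => exact ⟨0, by simp⟩
  | cons m t _ ih =>
    obtain ⟨x, hx⟩ := ih
    have hxm := sub_mem_finset_sup_inf hbot hsup hinf ha hx m
    rw [hinf, AddSubgroup.mem_sup] at hxm
    obtain ⟨y, hy, z, hz, hyz⟩ := hxm
    refine ⟨x - y, (Finset.forall_mem_cons _ _).2 ⟨?_, fun i hi => ?_⟩⟩
    · rwa [sub_right_comm, ← hyz, add_sub_cancel_left]
    · rw [sub_right_comm]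
      exact sub_mem (hx i hi) ((mem_finset_sup_iff hbot hsup).1 hy i hi)

end CongruenceGluing

section QuotientPresheaf

variable {X : TopCat.{u}} {A : Type u} [AddCommGroup A] {G : Opens X → AddSubgroup A}

theorem quotientPresheaf_map_mk (hG : ∀ U V, V ≤ U → G U ≤ G V) {U V : (Opens X)ᵒᵖ} (i : U ⟶ V)
    (x : A) : (quotientPresheaf A G hG).map i (QuotientAddGroup.mk x : A ⧸ G U.unop) =
      (QuotientAddGroup.mk x : A ⧸ G V.unop) :=
  rfl

theorem isFlasque_quotientPresheaf (hG : ∀ U V, V ≤ U → G U ≤ G V) :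
    (quotientPresheaf A G hG).IsFlasque where
  epi {U V} i := (AddCommGrpCat.epi_iff_surjective _).2 fun x => by
    obtain ⟨x, rfl⟩ := QuotientAddGroup.mk_surjective x
    exact ⟨QuotientAddGroup.mk x, rfl⟩

theorem isSheaf_quotientPresheaf [NoetherianSpace X] (hbot : G ⊥ = ⊤)
    (hsup : ∀ U V, G (U ⊔ V) = G U ⊓ G V) (hinf : ∀ U V, G (U ⊓ V) = G U ⊔ G V)
    (hG : ∀ U V, V ≤ U → G U ≤ G V) : (quotientPresheaf A G hG).IsSheaf := by
  rw [TopCat.Presheaf.isSheaf_iff_isSheafUniqueGluing]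
  intro ι U s hs
  choose a ha using fun i => QuotientAddGroup.mk_surjective (s i)
  obtain ⟨t, ht⟩ := Finset.exists_sup_eq_iSup U
  have mem_iSup {x : A} : x ∈ G (iSup U) ↔ ∀ i, x ∈ G (U i) :=
    ⟨fun hx i => hG _ _ (le_iSup U i) hx,
      fun hx => ht ▸ (mem_finset_sup_iff hbot hsup).2 fun i _ => hx i⟩
  have gluing_iff (x : A) : (quotientPresheaf A G hG).IsGluing U s
      (QuotientAddGroup.mk x : A ⧸ G (iSup U)) ↔ ∀ i, x - a i ∈ G (U i) := by
    refine forall_congr' fun i => ?_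
    rw [← ha, quotientPresheaf_map_mk]
    exact QuotientAddGroup.eq_iff_sub_mem
  have compatible (i j) : a i - a j ∈ G (U i ⊓ U j) := by
    have := hs i j
    rw [← ha, ← ha] at this
    exact QuotientAddGroup.eq_iff_sub_mem.1 this
  obtain ⟨x, hxt⟩ := exists_forall_sub_mem hbot hsup hinf compatible t
  have hx (i) : x - a i ∈ G (U i) := by
    simpa only [ht, inf_of_le_right (le_iSup U i)] using
      sub_mem_finset_sup_inf hbot hsup hinf compatible hxt i
  refine ⟨QuotientAddGroup.mk x, (gluing_iff x).2 hx, fun y hy => ?_⟩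
  obtain ⟨y, rfl⟩ := QuotientAddGroup.mk_surjective y
  refine QuotientAddGroup.eq_iff_sub_mem.2 (mem_iSup.2 fun i => ?_)
  rw [← sub_sub_sub_cancel_right y x (a i)]
  exact sub_mem ((gluing_iff y).1 hy i) (hx i)

end QuotientPresheaf

section MayerVietoris

variable {X : TopCat.{u}} {F : TopCat.Presheaf AddCommGrpCat.{u} X}

theorem mayerVietorisZero_injective (hF : F.IsSheaf) (U V : Opens X) :
    Function.Injective (mayerVietorisZero F U V) := fun x y h =>
  TopCat.Sheaf.eq_of_locally_eq₂ ⟨F, hF⟩ (homOfLE le_sup_left) (homOfLE le_sup_right) le_rfl x y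
    (congrArg Prod.fst h) (congrArg Prod.snd h)

theorem mayerVietoris_exact (hF : F.IsSheaf) (U V : Opens X) :
    Function.Exact (mayerVietorisZero F U V) (mayerVietorisOne F U V) := by
  let S := Opens.mayerVietorisSquare U V
  have hS : S.SheafCondition (F ⋙ forget _) := S.sheafCondition_of_sheaf
    ⟨_, (TopCat.Presheaf.isSheaf_iff_isSheaf_comp (forget AddCommGrpCat) F).1 hF⟩
  rintro ⟨x, y⟩
  refine ⟨fun h => ?_, ?_⟩
  · have hxy := sub_eq_zero.1 h
    exact ⟨hS.glue x y hxy, Prod.ext (hS.map_f₂₄_op_glue x y hxy) (hS.map_f₃₄_op_glue x y hxy)⟩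
  · rintro ⟨z, hz⟩
    rw [← hz]
    refine sub_eq_zero.2 ?_
    change (F.map _ ≫ F.map _) z = (F.map _ ≫ F.map _) z
    rw [← F.map_comp, ← F.map_comp]
    rfl

theorem mayerVietorisOne_surjective [F.IsFlasque] (U V : Opens X) :
    Function.Surjective (mayerVietorisOne F U V) := fun z => by
  obtain ⟨x, hx⟩ := (AddCommGrpCat.epi_iff_surjective _).1
    (TopCat.Presheaf.IsFlasque.epi (F := F) (homOfLE (inf_le_left : U ⊓ V ≤ U)).op) z
  exact ⟨(x, 0), by simp [mayerVietorisOne, hx]⟩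

end MayerVietoris

section BoxZero

variable (k : Type u) [Field k]

/-- Evaluation of homogeneous coordinates at `(0 : -1)`, the point `y = 0`; the sign makes
`X₀ - X₁` take the value `1`. -/
noncomputable def evalZero : MvPolynomial (Fin 2) k →+* Γ(Spec (.of k), ⊤) :=
  (Scheme.ΓSpecIso (.of k)).inv.hom.comp (MvPolynomial.eval ![0, -1])

theorem evalZero_C (a : k) :
    evalZero k (MvPolynomial.C a) = (Scheme.ΓSpecIso (.of k)).inv a := by
  simp [evalZero]

theorem evalZero_X_zero : evalZero k (MvPolynomial.X 0) = 0 := by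
  simp [evalZero]

theorem evalZero_X_sub_X : evalZero k (MvPolynomial.X 0 - MvPolynomial.X 1) = 1 := by
  simp [evalZero]

theorem map_evalZero_irrelevant :
    (HomogeneousIdeal.irrelevant (stdGrading k)).toIdeal.map (evalZero k) = ⊤ := by
  refine (Ideal.eq_top_iff_one _).2 (evalZero_X_sub_X k ▸ Ideal.mem_map_of_mem _ ?_)
  exact DirectSum.decompose_of_mem_ne (stdGrading k) (i := 1)
    ((MvPolynomial.isHomogeneous_X k 0).sub (MvPolynomial.isHomogeneous_X k 1)) one_ne_zero

/-- The rational point `y = 0` of `ℙ¹`. -/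
noncomputable def projLineZero : Spec (.of k) ⟶ Proj (stdGrading k) :=
  Proj.fromOfGlobalSections (stdGrading k) (evalZero k) (map_evalZero_irrelevant k)

theorem projLineZero_projLineStr : projLineZero k ≫ projLineStr k = 𝟙 _ := by
  rw [projLineZero, projLineStr, Proj.fromOfGlobalSections_toSpecZero_assoc, ← Spec.map_comp,
    ← CommRingCat.ofHom_comp]
  have h : ((evalZero k).comp (algebraMap (stdGrading k 0) (MvPolynomial (Fin 2) k))).comp
      (algebraMap k (stdGrading k 0)) = (Scheme.ΓSpecIso (.of k)).inv.hom :=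
    RingHom.ext (evalZero_C k)
  rw [h]
  exact toSpecΓ_SpecMap_ΓSpecIso_inv (.of k)

theorem projLineZero_preimage_basicOpen {r : MvPolynomial (Fin 2) k} (hr : r.IsHomogeneous 1) :
    projLineZero k ⁻¹ᵁ Proj.basicOpen (stdGrading k) r =
      (Spec (.of k)).basicOpen (evalZero k r) :=
  Proj.fromOfGlobalSections_preimage_basicOpen _ _ _ one_pos hr

theorem range_projLineZero_subset_box :
    Set.range (projLineZero k) ⊆ Set.range (box k).ι := by
  rw [Scheme.Opens.range_ι]
  rintro _ ⟨x, rfl⟩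
  have h := projLineZero_preimage_basicOpen k
    ((MvPolynomial.isHomogeneous_X k 0).sub (MvPolynomial.isHomogeneous_X k 1))
  rw [evalZero_X_sub_X, Scheme.basicOpen_one] at h
  exact h.ge (Opens.mem_top x)

/-- The rational point `y = 0` of `□`. -/
noncomputable def boxZero : Spec (.of k) ⟶ (box k).toScheme :=
  IsOpenImmersion.lift (box k).ι (projLineZero k) (range_projLineZero_subset_box k)

theorem boxZero_boxStr : boxZero k ≫ boxStr k = 𝟙 _ := by
  rw [boxZero, boxStr, IsOpenImmersion.lift_fac_assoc, projLineZero_projLineStr]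

theorem boxZero_mem_boxEnd (x : Spec (.of k)) : boxZero k x ∈ boxEnd k 0 := by
  have h := projLineZero_preimage_basicOpen k (MvPolynomial.isHomogeneous_X k 0)
  rw [evalZero_X_zero, Scheme.basicOpen_zero] at h
  have hx : projLineZero k x ∉ Proj.basicOpen (stdGrading k) (MvPolynomial.X 0) :=
    fun hx => h.le hx
  rw [Proj.mem_basicOpen, not_not, ← IsOpenImmersion.lift_fac (box k).ι (projLineZero k)
    (range_projLineZero_subset_box k)] at hx
  exact hx

end BoxZero

section CubeForget

variable {k : Type u} [Field k] {Y : Scheme.{u}} (f : Y ⟶ Spec (.of k)) (n : ℕ)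

theorem cubeCoord_boxStr (i : Fin n) : cubeCoord f n i ≫ boxStr k = cubeOverStr f n := by
  rw [cubeCoord, Category.assoc, WidePullback.π_arrow (fun _ : Fin n => boxStr k) i,
    ← pullback.condition]

theorem cubeOver_hom_ext {W : Scheme.{u}} {a b : W ⟶ cubeOver f n}
    (h : a ≫ pullback.fst f (cubeStr k n) = b ≫ pullback.fst f (cubeStr k n))
    (h' : ∀ i, a ≫ cubeCoord f n i = b ≫ cubeCoord f n i) : a = b := by
  refine pullback.hom_ext h (WidePullback.hom_ext _ _ _ (fun i => ?_) ?_)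
  · simpa only [cubeCoord, Category.assoc] using h' i
  · rw [Category.assoc, Category.assoc, ← pullback.condition, ← Category.assoc, h, Category.assoc]

theorem isPullback_cubeForget (i : Fin (n + 1)) :
    IsPullback (cubeForget f n i) (cubeCoord f (n + 1) i) (cubeOverStr f n) (boxStr k) := by
  refine ⟨⟨?_⟩, ⟨PullbackCone.IsLimit.mk _ (fun s => pullback.lift
    (s.fst ≫ pullback.fst _ _) (WidePullback.lift (s.fst ≫ cubeOverStr f n)
      (i.insertNth (α := fun _ => s.pt ⟶ (box k).toScheme) s.snd
        (fun j => s.fst ≫ cubeCoord f n j)) ?_) ?_) ?_ ?_ ?_⟩⟩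
  · rw [cubeCoord_boxStr, cubeOverStr, ← Category.assoc, cubeForget_fst]
  · intro j
    refine Fin.succAboveCases i ?_ (fun j => ?_) j
    · rw [Fin.insertNth_apply_same, s.condition]
    · rw [Fin.insertNth_apply_succAbove, Category.assoc, cubeCoord_boxStr]
  · rw [WidePullback.lift_base, Category.assoc]
  · intro s
    refine cubeOver_hom_ext f n ?_ fun j => ?_
    · rw [Category.assoc, cubeForget_fst, pullback.lift_fst]
    · rw [Category.assoc, cubeForget_coord, cubeCoord, ← Category.assoc, pullback.lift_snd,
        WidePullback.lift_π, Fin.insertNth_apply_succAbove]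
  · intro s
    rw [cubeCoord, ← Category.assoc, pullback.lift_snd, WidePullback.lift_π,
      Fin.insertNth_apply_same]
  · intro s m h1 h2
    refine cubeOver_hom_ext f (n + 1) ?_ fun j => ?_
    · rw [pullback.lift_fst, ← h1, Category.assoc, cubeForget_fst]
    · conv_rhs => rw [cubeCoord, ← Category.assoc, pullback.lift_snd, WidePullback.lift_π]
      refine Fin.succAboveCases i ?_ (fun j => ?_) j
      · rw [Fin.insertNth_apply_same, ← h2]
      · rw [Fin.insertNth_apply_succAbove, ← h1, Category.assoc, cubeForget_coord]

theorem isOpenMap_cubeForget (i : Fin (n + 1)) : IsOpenMap (cubeForget f n i) := by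
  have : UniversallyOpen (boxStr k) := inferInstance
  have : UniversallyOpen (cubeForget f n i) :=
    MorphismProperty.of_isPullback (isPullback_cubeForget f n i).flip this
  exact (cubeForget f n i).isOpenMap

theorem cubeForget_preimage_cubeFace (i : Fin (n + 1)) (s : Finset (Fin n))
    (ε : Fin n → Fin 2) :
    cubeForget f n i ⁻¹' cubeFace f n s ε =
      cubeFace f (n + 1) (s.map i.succAboveEmb) (i.insertNth (α := fun _ => Fin 2) 0 ε) := by
  ext x
  simp only [cubeFace, Set.mem_preimage, Set.mem_ofPred_eq, Finset.mem_map,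
    forall_exists_index, and_imp, forall_apply_eq_imp_iff₂, Fin.succAboveEmb_apply,
    Fin.insertNth_apply_succAbove]
  refine forall₂_congr fun j _ => ?_
  rw [← Scheme.Hom.comp_apply, cubeForget_coord]

variable {n}

/-- The section `yᵢ = 0` of the projection `□ⁿ⁺¹_Y ⟶ □ⁿ_Y` that forgets the `i`-th coordinate. -/
noncomputable def cubeZeroSection (i : Fin (n + 1)) : cubeOver f n ⟶ cubeOver f (n + 1) :=
  (isPullback_cubeForget f n i).lift (𝟙 _) (cubeOverStr f n ≫ boxZero k)
    (by rw [Category.id_comp, Category.assoc, boxZero_boxStr, Category.comp_id])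

theorem cubeZeroSection_forget (i : Fin (n + 1)) : cubeZeroSection f i ≫ cubeForget f n i = 𝟙 _ :=
  (isPullback_cubeForget f n i).lift_fst _ _ _

theorem cubeForget_cubeZeroSection_apply (i : Fin (n + 1)) (x : cubeOver f n) :
    cubeForget f n i (cubeZeroSection f i x) = x := by
  rw [← Scheme.Hom.comp_apply, cubeZeroSection_forget]; rfl

theorem cubeZeroSection_coord_mem_boxEnd (i : Fin (n + 1)) (x : cubeOver f n) :
    cubeCoord f (n + 1) i (cubeZeroSection f i x) ∈ boxEnd k 0 := by
  rw [← Scheme.Hom.comp_apply, cubeZeroSection, (isPullback_cubeForget f n i).lift_snd,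
    Scheme.Hom.comp_apply]
  exact boxZero_mem_boxEnd k _

theorem isInducing_cubeZeroSection (i : Fin (n + 1)) :
    Topology.IsInducing (cubeZeroSection f i) := by
  refine .of_comp (cubeZeroSection f i).continuous (cubeForget f n i).continuous ?_
  have h : cubeForget f n i ∘ cubeZeroSection f i = id :=
    funext (cubeForget_cubeZeroSection_apply f i)
  exact h ▸ .id

theorem mapsTo_cubeZeroSection_cubeFace (i : Fin (n + 1)) (s : Finset (Fin n)) (ε : Fin n → Fin 2) :
    Set.MapsTo (cubeZeroSection f i) (cubeFace f n s ε)
      (cubeFace f (n + 1) (Finset.cons i (s.map i.succAboveEmb) (by simp [Fin.succAbove_ne]))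
        (i.insertNth (α := fun _ => Fin 2) 0 ε)) := by
  intro x hx
  refine (Finset.forall_mem_cons _ _).2 ⟨?_, ?_⟩
  · rw [Fin.insertNth_apply_same]
    exact cubeZeroSection_coord_mem_boxEnd f i x
  · rw [← cubeForget_cubeZeroSection_apply f i x] at hx
    exact (cubeForget_preimage_cubeFace f n i s ε).le hx

-- The section `yᵢ = 0` embeds `C ∩ F` into the intersection of `Z` with a face of codimension
-- `codim F + 1`.
theorem krullDim_inter_cubeFace_add_card_add_one_le {d : ℤ} {i : Fin (n + 1)}
    {Z : IrreducibleCloseds (cubeOver f (n + 1))} (hZ : IsAdmissible f d (n + 1) Z)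
    {C : Set (cubeOver f n)} (hC : cubeForget f n i ⁻¹' C = Z) (s : Finset (Fin n))
    (ε : Fin n → Fin 2) :
    topologicalKrullDim (C ∩ cubeFace f n s ε : Set (cubeOver f n)) + s.card + 1 ≤
      topologicalKrullDim (Z : Set (cubeOver f (n + 1))) := by
  have hmapsZ : Set.MapsTo (cubeZeroSection f i) C Z := fun x hx =>
    hC.le (by rwa [Set.mem_preimage, cubeForget_cubeZeroSection_apply])
  have hmaps := hmapsZ.inter_inter (mapsTo_cubeZeroSection_cubeFace f i s ε)
  have hdim := (((isInducing_cubeZeroSection f i).comp .subtypeVal).codRestrict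
    (fun x => hmaps x.2)).topologicalKrullDim_le
  have hproper := (add_le_add_left hdim _).trans (hZ.proper _ _)
  rwa [Finset.card_cons, Finset.card_map, Nat.cast_add, Nat.cast_one, ← add_assoc] at hproper

theorem IsAdmissible.of_cubeForget_preimage {d : ℤ} {i : Fin (n + 1)}
    {Z : IrreducibleCloseds (cubeOver f (n + 1))} (hZ : IsAdmissible f d (n + 1) Z)
    {C : IrreducibleCloseds (cubeOver f n)}
    (hC : cubeForget f n i ⁻¹' (C : Set (cubeOver f n)) = Z) {r : ℕ} (hr : (r : ℤ) = d + n)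
    (hCr : topologicalKrullDim (C : Set (cubeOver f n)) = r) : IsAdmissible f d n C where
  dim_eq := ⟨r, hr, hCr⟩
  proper s ε := by
    obtain ⟨q, hq, hZq⟩ := hZ.dim_eq
    have hqr : q = r + 1 := by push_cast at hq; omega
    have h := krullDim_inter_cubeFace_add_card_add_one_le f hZ hC s ε
    rw [hZq, hqr, Nat.cast_add, Nat.cast_one] at h
    exact hCr ▸ ENat.WithBot.add_le_add_one_right_iff.1 h

end CubeForget

section AdmissibleRestriction

variable {k : Type u} [Field k] {Y Y' : Scheme.{u}} (f : Y ⟶ Spec (.of k))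
  (f' : Y' ⟶ Spec (.of k)) (j : Y' ⟶ Y) (h : j ≫ f = f')

theorem range_cubeMap (n : ℕ) :
    Set.range (cubeMap f f' j h n) = pullback.fst f (cubeStr k n) ⁻¹' Set.range j := by
  rw [cubeMap, Scheme.Pullback.range_map]
  have : Set.range (𝟙 (cube k n) : cube k n ⟶ cube k n) = Set.univ :=
    Set.range_eq_univ.2 fun x => ⟨x, rfl⟩
  rw [this, Set.preimage_univ, Set.inter_univ]

theorem not_nonempty_preimage_cubeMap_iff (n : ℕ) (S : Set (cubeOver f n)) :
    ¬ (cubeMap f f' j h n ⁻¹' S).Nonempty ↔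
      S ⊆ pullback.fst f (cubeStr k n) ⁻¹' (Set.range j)ᶜ := by
  rw [Set.not_nonempty_iff_eq_empty, Set.preimage_eq_empty_iff, range_cubeMap,
    ← Set.subset_compl_iff_disjoint_right, Set.preimage_compl]

variable [IsOpenImmersion j]

theorem cubeForget_preimage_image_cubeMap (n : ℕ) (i : Fin (n + 1)) (S : Set (cubeOver f' n)) :
    cubeForget f n i ⁻¹' (cubeMap f f' j h n '' S) =
      cubeMap f f' j h (n + 1) '' (cubeForget f' n i ⁻¹' S) := by
  have comm (x) : cubeForget f n i (cubeMap f f' j h (n + 1) x) =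
      cubeMap f f' j h n (cubeForget f' n i x) := by
    rw [← Scheme.Hom.comp_apply, cubeMap_forget, Scheme.Hom.comp_apply]
  ext x
  constructor
  · rintro ⟨s, hs, hx⟩
    have hr : x ∈ Set.range (cubeMap f f' j h (n + 1)) := by
      have h1 : cubeForget f n i x ∈ Set.range (cubeMap f f' j h n) := ⟨s, hx⟩
      rw [range_cubeMap] at h1 ⊢
      rwa [Set.mem_preimage, ← Scheme.Hom.comp_apply, cubeForget_fst] at h1
    obtain ⟨x, rfl⟩ := hr
    refine ⟨x, ?_, rfl⟩
    rw [comm] at hx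
    rwa [Set.mem_preimage, ← (cubeMap f f' j h n).isOpenEmbedding.injective hx]
  · rintro ⟨x, hx, rfl⟩
    exact ⟨_, hx, (comm x).symm⟩

theorem closure_image_preimage_cubeMap {n : ℕ} (Z : IrreducibleCloseds (cubeOver f n))
    (hZ : (cubeMap f f' j h n ⁻¹' (Z : Set (cubeOver f n))).Nonempty) :
    closure (cubeMap f f' j h n '' (cubeMap f f' j h n ⁻¹' (Z : Set (cubeOver f n)))) = Z := by
  rw [Set.image_preimage_eq_inter_range]
  refine (closure_minimal Set.inter_subset_left Z.isClosed).antisymm ?_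
  refine subset_closure_inter_of_isPreirreducible_of_isOpen Z.isIrreducible.isPreirreducible
    (cubeMap f f' j h n).isOpenEmbedding.isOpen_range ?_
  obtain ⟨x, hx⟩ := hZ
  exact ⟨_, hx, x, rfl⟩

variable [LocallyOfFiniteType f] {d : ℤ} {n : ℕ}

theorem Admissible.restrict_injective {Z₁ Z₂ : Admissible f d n}
    (h₁ : (cubeMap f f' j h n ⁻¹' (Z₁.1 : Set (cubeOver f n))).Nonempty)
    (h₂ : (cubeMap f f' j h n ⁻¹' (Z₂.1 : Set (cubeOver f n))).Nonempty)
    (e : Z₁.restrict f f' j h h₁ = Z₂.restrict f f' j h h₂) : Z₁ = Z₂ := by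
  have e' : cubeMap f f' j h n ⁻¹' (Z₁.1 : Set (cubeOver f n)) =
      cubeMap f f' j h n ⁻¹' (Z₂.1 : Set (cubeOver f n)) :=
    congrArg (fun Z : Admissible f' d n => (Z.1 : Set (cubeOver f' n))) e
  refine Subtype.ext (IrreducibleCloseds.ext ?_)
  rw [← closure_image_preimage_cubeMap f f' j h Z₁.1 h₁, e',
    closure_image_preimage_cubeMap f f' j h Z₂.1 h₂]

theorem IsDegenerate.of_restrict (Z : Admissible f d n)
    (hZ : (cubeMap f f' j h n ⁻¹' (Z.1 : Set (cubeOver f n))).Nonempty)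
    (hd : IsDegenerate f' d n (Z.restrict f f' j h hZ)) : IsDegenerate f d n Z := by
  match n, Z, hZ, hd with
  | n + 1, Z, hZ, ⟨i, Z', e⟩ =>
    have e : cubeMap f f' j h (n + 1) ⁻¹' (Z.1 : Set (cubeOver f (n + 1))) =
      cubeForget f' n i ⁻¹' (Z'.1 : Set (cubeOver f' n)) := e
    let j' := cubeMap f f' j h n
    let C : IrreducibleCloseds (cubeOver f n) := IrreducibleCloseds.map j' j'.continuous Z'.1
    have hC : cubeForget f n i ⁻¹' (C : Set (cubeOver f n)) = Z.1 := by
      change cubeForget f n i ⁻¹' closure (j' '' Z'.1) = _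
      rw [(isOpenMap_cubeForget f n i).preimage_closure_eq_closure_preimage
        (cubeForget f n i).continuous, cubeForget_preimage_image_cubeMap, ← e,
        closure_image_preimage_cubeMap f f' j h Z.1 hZ]
    have hC' : j' ⁻¹' (C : Set (cubeOver f n)) = Z'.1 := by
      change j' ⁻¹' closure (j' '' Z'.1) = _
      rw [← j'.isOpenEmbedding.isInducing.closure_eq_preimage_closure_image,
        Z'.1.isClosed.closure_eq]
    have hdim := krullDim_preimage (cubeOverStr f n) j' C
      (hC'.symm ▸ Z'.1.isIrreducible.nonempty)
    obtain ⟨r, hr, hr'⟩ := Z'.2.dim_eq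
    rw [hC', hr'] at hdim
    exact ⟨i, ⟨C, Z.2.of_cubeForget_preimage f hC hr hdim.symm⟩, hC.symm⟩

end AdmissibleRestriction

section Cycles

theorem closure_single_eq_supported {α : Type*} (s : Set α) :
    AddSubgroup.closure {x | ∃ a, a ∈ s ∧ x = Finsupp.single a (1 : ℤ)} =
      (Finsupp.supported ℤ ℤ s).toAddSubgroup := by
  rw [Finsupp.supported_eq_span_single, Submodule.span_int_eq_addSubgroupClosure]
  simp only [Set.image, eq_comm]

variable {k : Type u} [Field k] {Y Y' : Scheme.{u}} (f : Y ⟶ Spec (.of k))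
  (f' : Y' ⟶ Spec (.of k)) (j : Y' ⟶ Y) (h : j ≫ f = f') (d : ℤ) (n : ℕ)

theorem degnCycles_eq_supported :
    degnCycles f d n = (Finsupp.supported ℤ ℤ {Z | IsDegenerate f d n Z}).toAddSubgroup :=
  closure_single_eq_supported _

/-- The admissible integral closed subschemes of `□ⁿ_Y` that lie over the subset `W` of `Y`. -/
def admissibleOver (W : Set Y) : Set (Admissible f d n) :=
  {Z | (Z.1 : Set (cubeOver f n)) ⊆ pullback.fst f (cubeStr k n) ⁻¹' W}

theorem admissibleOver_inter (W₁ W₂ : Set Y) :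
    admissibleOver f d n (W₁ ∩ W₂) = admissibleOver f d n W₁ ∩ admissibleOver f d n W₂ :=
  Set.ext fun _ => Set.subset_inter_iff

theorem admissibleOver_union {W₁ W₂ : Set Y} (hW₁ : IsClosed W₁) (hW₂ : IsClosed W₂) :
    admissibleOver f d n (W₁ ∪ W₂) = admissibleOver f d n W₁ ∪ admissibleOver f d n W₂ := by
  refine subset_antisymm (fun Z hZ => ?_) (Set.union_subset ?_ ?_)
  · exact isPreirreducible_iff_isClosed_union_isClosed.1 Z.1.isIrreducible.isPreirreducible _ _
      (hW₁.preimage (pullback.fst f (cubeStr k n)).continuous)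
      (hW₂.preimage (pullback.fst f (cubeStr k n)).continuous) hZ
  · exact fun Z hZ => hZ.trans (Set.preimage_mono Set.subset_union_left)
  · exact fun Z hZ => hZ.trans (Set.preimage_mono Set.subset_union_right)

variable [IsOpenImmersion j] [LocallyOfFiniteType f]

theorem admRestrict_apply_restrict (a : AdmCycles f d n) (Z : Admissible f d n)
    (hZ : (cubeMap f f' j h n ⁻¹' (Z.1 : Set (cubeOver f n))).Nonempty) :
    admRestrict f f' j h d n a (Z.restrict f f' j h hZ) = a Z := by
  classical
  induction a using Finsupp.induction_linear with
  | zero => rw [map_zero]; rfl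
  | add a b ha hb => rw [map_add, Finsupp.add_apply, ha, hb, Finsupp.add_apply]
  | single Z' m =>
    rw [admRestrict, Finsupp.liftAddHom_apply_single]
    split_ifs with hZ'
    · rw [Finsupp.singleAddHom_apply, Finsupp.single_apply, Finsupp.single_apply]
      refine if_congr ⟨Admissible.restrict_injective f f' j h hZ' hZ, ?_⟩ rfl rfl
      rintro rfl
      rfl
    · have hne : Z ≠ Z' := by
        rintro rfl
        exact hZ' hZ
      rw [AddMonoidHom.zero_apply, Finsupp.single_eq_of_ne hne]
      rfl

theorem comap_admRestrict_degnCycles :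
    (degnCycles f' d n).comap (admRestrict f f' j h d n) =
      (Finsupp.supported ℤ ℤ
        ({Z | IsDegenerate f d n Z} ∪ admissibleOver f d n (Set.range j)ᶜ)).toAddSubgroup := by
  refine le_antisymm (fun a ha => ?_) ?_
  · refine (Finsupp.mem_supported' ℤ _).2 fun Z hZ => ?_
    have hne : (cubeMap f f' j h n ⁻¹' (Z.1 : Set (cubeOver f n))).Nonempty :=
      by_contra fun hne => hZ (.inr ((not_nonempty_preimage_cubeMap_iff f f' j h n _).1 hne))
    rw [← admRestrict_apply_restrict f f' j h d n a Z hne]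
    rw [AddSubgroup.mem_comap, degnCycles_eq_supported] at ha
    exact (Finsupp.mem_supported' ℤ _).1 ha _ fun hd =>
      hZ (.inl (IsDegenerate.of_restrict f f' j h Z hne hd))
  · rw [← closure_single_eq_supported, AddSubgroup.closure_le]
    rintro _ ⟨Z, hd | hZ, rfl⟩
    · exact degnCycles_le_comap f f' j h d n (AddSubgroup.subset_closure ⟨Z, hd, rfl⟩)
    · have hne := (not_nonempty_preimage_cubeMap_iff f f' j h n _).2 hZ
      simp [admRestrict, hne]

end Cycles

section SupportedCycles

variable {k : Type u} [Field k] {Y : Scheme.{u}} (f : Y ⟶ Spec (.of k)) [LocallyOfFiniteType f]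
  (d : ℤ) (n : ℕ)

theorem comap_mk_supportedCycles (W : Closeds Y) :
    (supportedCycles f d n W).comap (QuotientAddGroup.mk' (degnCycles f d n)) =
      (Finsupp.supported ℤ ℤ
        ({Z | IsDegenerate f d n Z} ∪ admissibleOver f d n (W : Set Y))).toAddSubgroup := by
  have hW : (W : Set Y) = (Set.range (Scheme.Opens.ι W.compl))ᶜ := by
    rw [Scheme.Opens.range_ι]; exact (compl_compl _).symm
  rw [hW, ← comap_admRestrict_degnCycles f _ _ rfl]
  exact AddSubgroup.ext fun a => QuotientAddGroup.eq_zero_iff _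

theorem supportedCycles_top : supportedCycles f d n ⊤ = ⊤ := by
  refine AddSubgroup.comap_injective (QuotientAddGroup.mk'_surjective (degnCycles f d n)) ?_
  have h : {Z | IsDegenerate f d n Z} ∪ admissibleOver f d n Set.univ = Set.univ :=
    Set.eq_univ_of_forall fun Z => .inr (Set.subset_univ _)
  rw [comap_mk_supportedCycles, AddSubgroup.comap_top, Closeds.coe_top, h, Finsupp.supported_univ,
    Submodule.top_toAddSubgroup]

theorem supportedCycles_inf (W₁ W₂ : Closeds Y) :
    supportedCycles f d n (W₁ ⊓ W₂) = supportedCycles f d n W₁ ⊓ supportedCycles f d n W₂ := by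
  refine AddSubgroup.comap_injective (QuotientAddGroup.mk'_surjective (degnCycles f d n)) ?_
  rw [AddSubgroup.comap_inf]
  simp only [comap_mk_supportedCycles]
  rw [Closeds.coe_inf, admissibleOver_inter, Set.union_inter_distrib_left, Finsupp.supported_inter]
  rfl

theorem supportedCycles_sup (W₁ W₂ : Closeds Y) :
    supportedCycles f d n (W₁ ⊔ W₂) = supportedCycles f d n W₁ ⊔ supportedCycles f d n W₂ := by
  refine AddSubgroup.comap_injective (QuotientAddGroup.mk'_surjective (degnCycles f d n)) ?_
  rw [← AddSubgroup.comap_sup_eq _ _ _ (QuotientAddGroup.mk'_surjective _)]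
  simp only [comap_mk_supportedCycles]
  rw [Closeds.coe_sup, admissibleOver_union f d n W₁.isClosed W₂.isClosed,
    Set.union_union_distrib_left, Finsupp.supported_union]
  exact (AddSubgroup.toIntSubmodule (M := AdmCycles f d n)).symm.map_sup _ _

theorem isSheaf_cyclePresheaf [NoetherianSpace Y] : (cyclePresheaf f d n).IsSheaf :=
  isSheaf_quotientPresheaf
    ((congrArg _ (Opens.complOrderIso Y).map_bot).trans (supportedCycles_top f d n))
    (fun U V => (congrArg _ ((Opens.complOrderIso Y).map_sup U V)).trans
      (supportedCycles_inf f d n U.compl V.compl))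
    (fun U V => (congrArg _ ((Opens.complOrderIso Y).map_inf U V)).trans
      (supportedCycles_sup f d n U.compl V.compl)) _

theorem isFlasque_cyclePresheaf : (cyclePresheaf f d n).IsFlasque :=
  isFlasque_quotientPresheaf _

end SupportedCycles

theorem proposition4p4 {k : Type u} [Field k] {Y : Scheme.{u}} (f : Y ⟶ Spec (.of k))
    [LocallyOfFiniteType f] [QuasiCompact f] (d : ℤ) (n : ℕ) :
    (cyclePresheaf f d n).IsSheaf ∧ (cyclePresheaf f d n).IsFlasque ∧
      ∀ U V : Y.Opens,
        Function.Injective (mayerVietorisZero (cyclePresheaf f d n) U V) ∧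
        Function.Exact (mayerVietorisZero (cyclePresheaf f d n) U V)
          (mayerVietorisOne (cyclePresheaf f d n) U V) ∧
        Function.Surjective (mayerVietorisOne (cyclePresheaf f d n) U V) := by
  have : IsLocallyNoetherian Y := LocallyOfFiniteType.isLocallyNoetherian f
  have : CompactSpace Y := QuasiCompact.compactSpace_of_compactSpace f
  have : IsNoetherian Y := {}
  have sheaf := isSheaf_cyclePresheaf f d n
  have flasque := isFlasque_cyclePresheaf f d n
  exact ⟨sheaf, flasque, fun U V => ⟨mayerVietorisZero_injective sheaf U V,
    mayerVietoris_exact sheaf U V, mayerVietorisOne_surjective U V⟩⟩
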